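/- Let $n \ge 1$. A (convex) polytope in $\mathbb{R}^n$ is a bounded intersection of finitely many closed halfspaces. For an integer $k \ge 0$, a $k$-face of a polytope $P$ is a nonempty set of affine dimension $k$ of the form $P \cap \{x : \langle c, x\rangle = b\}$, where $c \in \mathbb{R}^n$, $b \in \mathbb{R}$ and $\langle c, x\rangle \le b$ for all $x \in P$. A polytopal tiling of $\mathbb{R}^n$ is a collection $\mathcal{T}$ of polytopes with nonempty interior whose union is $\mathbb{R}^n$ and whose interiors are pairwise disjoint; it is locally finite if each bounded subset of $\mathbb{R}^n$ intersects only finitely many members of $\mathcal{T}$. Let $\mathcal{T}$ be a locally finite polytopal tiling of $\mathbb{R}^n$, let $0 \le k \le n-1$, and let $F$ be a $k$-face of a tile $T \in \mathcal{T}$. Then there are finitely many sets $F_1, \dots, F_m$, each of which is a $k$-face of some tile of $\mathcal{T}$ different from $T$, such that $F \subseteq F_1 \cup \dots \cup F_m$. -/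

import Mathlib

/-- A closed halfspace of `ℝⁿ`: the solution set of one linear inequality with nonzero
normal vector. -/
def IsClosedHalfspace {n : ℕ} (H : Set (EuclideanSpace ℝ (Fin n))) : Prop :=
  ∃ a : EuclideanSpace ℝ (Fin n), a ≠ 0 ∧ ∃ b : ℝ, H = {x | inner ℝ a x ≤ b}

/-- A convex polyhedron: the intersection of finitely many closed halfspaces. -/
def IsPolyhedron {n : ℕ} (P : Set (EuclideanSpace ℝ (Fin n))) : Prop :=
  ∃ S : Set (Set (EuclideanSpace ℝ (Fin n))),
    S.Finite ∧ (∀ H ∈ S, IsClosedHalfspace H) ∧ P = ⋂₀ S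

/-- A convex polytope: a bounded convex polyhedron. -/
def IsPolytope {n : ℕ} (P : Set (EuclideanSpace ℝ (Fin n))) : Prop :=
  IsPolyhedron P ∧ Bornology.IsBounded P

/-- `F` is a `k`-face of `P`: a nonempty set of affine dimension `k` consisting of all points
of `P` at which some linear functional attains its maximum over `P`; that is, `F` is cut out of
`P` by a linear inequality valid on `P` (the zero functional gives `P` itself). -/
def IsKFace {n : ℕ} (k : ℕ) (P F : Set (EuclideanSpace ℝ (Fin n))) : Prop :=
  F.Nonempty ∧ IsExposed ℝ P F ∧ Module.finrank ℝ (vectorSpan ℝ F) = k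

/-- A polytopal tiling of `ℝⁿ`: a collection of (full-dimensional) convex polytopes that is
both a covering and a packing of `ℝⁿ`. -/
structure IsPolytopalTiling {n : ℕ} (𝒯 : Set (Set (EuclideanSpace ℝ (Fin n)))) : Prop where
  isPolytope : ∀ T ∈ 𝒯, IsPolytope T
  interior_nonempty : ∀ T ∈ 𝒯, (interior T).Nonempty
  covering : ⋃₀ 𝒯 = Set.univ
  packing : ∀ T ∈ 𝒯, ∀ T' ∈ 𝒯, T ≠ T' → Disjoint (interior T) (interior T')

/-- Each bounded set meets only finitely many members of the collection. -/
def IsLocallyFiniteTiling {n : ℕ} (𝒯 : Set (Set (EuclideanSpace ℝ (Fin n)))) : Prop :=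
  ∀ U : Set (EuclideanSpace ℝ (Fin n)), Bornology.IsBounded U →
    {T ∈ 𝒯 | (T ∩ U).Nonempty}.Finite

/-! It suffices to find, for each point `p` of `F`, a tile `T' ≠ T` through `p` whose lineality
space at `p` lies in that of `T` (`IsPolytopalTiling.exists_lineality_le`). The lineality of `T` at
`p` has dimension at most `k`, so the same holds for `T'`, and `p` lies on a `k`-face of `T'`. Only
finitely many tiles meet the bounded set `T`, and each contributes finitely many faces.

Suppose no such `T'` exists. Then the open tangent cone at `p` of every other tile through `p` is
invariant under some `u` outside the lineality of `T`. These cones, with that of `T`, partition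
space up to a null set, so off a null set invariant under all these `u` the indicator of the cone of
`T` is 1 minus finitely many periodic indicators. But that indicator lives in the half-spaces given
by the normals of `T` at `p`, and each `u` is non-orthogonal to one of them. By
`eq_zero_of_eq_sum_periodic` it vanishes, although the cone is open and nonempty. -/

open Filter Topology MeasureTheory

/-! ### Sums of periodic functions with one-sided support -/

section Periodic

variable {E : Type*} [NormedAddCommGroup E] [InnerProductSpace ℝ E]

/-- A function whose support is bounded above in the directions of `A`, and which is a finite sum
of functions each having a period that is not orthogonal to `A`, vanishes. -/
theorem eq_zero_of_eq_sum_periodic {ι : Type*} (s : Finset ι) (u : ι → E) (A : Set E)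
    (hu : ∀ i ∈ s, ∃ a ∈ A, inner ℝ a (u i) ≠ 0) (f : ι → E → ℤ)
    (hf : ∀ i ∈ s, ∀ x, f i (x + u i) = f i x) (h : E → ℤ)
    (hh : ∀ a ∈ A, ∃ c : ℝ, ∀ x, h x ≠ 0 → inner ℝ a x ≤ c)
    (hsum : ∀ x, h x = ∑ i ∈ s, f i x) : ∀ x, h x = 0 := by
  classical
  induction s using Finset.induction_on generalizing f h with
  | empty => simpa using hsum
  | insert j s hj ih =>
    -- Differencing along `u j` kills the `j`-th summand and preserves the other periods and the
    -- support bounds.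
    have hper : ∀ x, h (x + u j) - h x = 0 := by
      refine ih (fun i hi => hu i (Finset.mem_insert_of_mem hi))
        (fun i x => f i (x + u j) - f i x) ?_ (fun x => h (x + u j) - h x) ?_ ?_
      · intro i hi x
        have hi' := hf i (Finset.mem_insert_of_mem hi)
        simp only [hi', add_right_comm x (u i) (u j)]
      · intro a ha
        obtain ⟨c, hc⟩ := hh a ha
        refine ⟨max c (c - inner ℝ a (u j)), fun x hx => ?_⟩
        by_cases hx0 : h x = 0
        · have : h (x + u j) ≠ 0 := fun h0 => hx (by simp [h0, hx0])
          have := hc _ this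
          rw [inner_add_right] at this
          exact le_max_of_le_right (by linarith)
        · exact le_max_of_le_left (hc x hx0)
      · intro x
        simp only [hsum, Finset.sum_insert hj, Finset.sum_sub_distrib,
          hf j (Finset.mem_insert_self j s)]
        ring
    obtain ⟨a, ha, hau⟩ := hu j (Finset.mem_insert_self j s)
    obtain ⟨c, hc⟩ := hh a ha
    have hP : Function.Periodic h (u j) := fun x => sub_eq_zero.mp (hper x)
    intro x
    by_contra hx
    -- Now `h` itself has period `u j`, so a nonzero value would recur arbitrarily far in direction
    -- `a`.
    have key : ∀ m : ℤ, inner ℝ a x + m * inner ℝ a (u j) ≤ c := by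
      intro m
      have := hc (x + m • u j) (by rw [hP.zsmul m x]; exact hx)
      rwa [inner_add_right, ← Int.cast_smul_eq_zsmul ℝ, inner_smul_right] at this
    rcases lt_or_gt_of_ne hau with hneg | hpos
    · obtain ⟨m, hm⟩ := exists_int_lt ((c - inner ℝ a x) / inner ℝ a (u j))
      have := key m
      rw [lt_div_iff_of_neg hneg] at hm
      linarith
    · obtain ⟨m, hm⟩ := exists_int_gt ((c - inner ℝ a x) / inner ℝ a (u j))
      have := key m
      rw [div_lt_iff₀ hpos] at hm
      linarith

end Periodic

/-! ### Translation-invariant sets of generic points -/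

section Generic

variable {E : Type*} [NormedAddCommGroup E]

/-- The points none of whose translates by integer combinations of the `u i` lies in `N`. -/
def avoidingPoints {ι : Type*} (u : ι → E) (N : Set E) : Set E :=
  {x | ∀ c : ι →₀ ℤ, x + Finsupp.linearCombination ℤ u c ∉ N}

theorem add_mem_avoidingPoints_iff {ι : Type*} (u : ι → E) (N : Set E) (i : ι) (x : E) :
    x + u i ∈ avoidingPoints u N ↔ x ∈ avoidingPoints u N := by
  constructor
  · intro h c
    have := h (c - Finsupp.single i 1)
    rwa [map_sub, Finsupp.linearCombination_single, one_smul, add_add_sub_cancel] at this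
  · intro h c
    have := h (Finsupp.single i 1 + c)
    rwa [map_add, Finsupp.linearCombination_single, one_smul, ← add_assoc] at this

theorem notMem_of_mem_avoidingPoints {ι : Type*} {u : ι → E} {N : Set E} {x : E}
    (h : x ∈ avoidingPoints u N) : x ∉ N := by
  simpa using h 0

theorem ae_mem_avoidingPoints [MeasurableSpace E] [BorelSpace E] {ι : Type*} [Countable ι] (u : ι → E) {N : Set E}
    {μ : Measure E} [μ.IsAddRightInvariant] (hN : μ N = 0) :
    ∀ᵐ x ∂μ, x ∈ avoidingPoints u N := by
  refine ae_all_iff.mpr fun c => ?_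
  rw [ae_iff]
  simpa [Set.preimage] using (measure_preimage_add_right μ _ N).trans hN

end Generic

/-! ### Open tangent cones of convex sets -/

section TangentCone

variable {E : Type*} [NormedAddCommGroup E] [NormedSpace ℝ E]

/-- The span of the directions in which `T` extends both ways from `p`. -/
def lineality (T : Set E) (p : E) : Submodule ℝ E :=
  Submodule.span ℝ {u | p + u ∈ T ∧ p - u ∈ T}

/-- The directions pointing from `p` into the interior of `T`. -/
def openTangentCone (T : Set E) (p : E) : Set E :=
  {v | ∃ ε : ℝ, 0 < ε ∧ p + ε • v ∈ interior T}

theorem sub_mem_openTangentCone {T : Set E} {p x : E} (hx : x ∈ interior T) :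
    x - p ∈ openTangentCone T p :=
  ⟨1, one_pos, by simpa using hx⟩

theorem eventually_mem_interior_of_mem_openTangentCone {T : Set E} (hT : Convex ℝ T) {p v : E}
    (hp : p ∈ T) (hv : v ∈ openTangentCone T p) :
    ∀ᶠ ε : ℝ in 𝓝[>] 0, p + ε • v ∈ interior T := by
  obtain ⟨δ, hδ, h⟩ := hv
  filter_upwards [Ioo_mem_nhdsGT hδ] with ε hε
  have := hT.combo_interior_self_mem_interior h hp (a := ε / δ) (b := 1 - ε / δ)
    (div_pos hε.1 hδ) (by rw [sub_nonneg, div_le_one hδ]; exact hε.2.le) (by ring)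
  convert this using 1
  rw [smul_add, smul_smul, div_mul_cancel₀ _ hδ.ne', sub_smul, one_smul]
  abel

/-- The midpoint of `p + ε • v`, interior to `T`, and `p + ε • u`, in `T`, is interior. Applied to
`u` and `-u`, this makes lineality directions periods of the cone. -/
theorem add_mem_openTangentCone {T : Set E} (hT : Convex ℝ T) {p v u : E}
    (hp : p ∈ T) (hv : v ∈ openTangentCone T p) (hu : p + u ∈ T) :
    v + u ∈ openTangentCone T p := by
  obtain ⟨ε, hε, hε0, hε1⟩ :=
    ((eventually_mem_interior_of_mem_openTangentCone hT hp hv).and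
      (Ioo_mem_nhdsGT one_pos)).exists
  have hεu : p + ε • u ∈ T := by
    have := hT hp hu (sub_nonneg.mpr hε1.le) hε0.le (by ring)
    convert this using 1
    rw [smul_add, sub_smul, one_smul]
    abel
  refine ⟨ε / 2, half_pos hε0, ?_⟩
  have := hT.combo_interior_self_mem_interior hε hεu (a := 1 / 2) (b := 1 / 2)
    (by norm_num) (by norm_num) (by norm_num)
  convert this using 1
  module

theorem add_mem_openTangentCone_iff {T : Set E} (hT : Convex ℝ T) {p u : E}
    (hp : p ∈ T) (hu : p + u ∈ T ∧ p - u ∈ T) (v : E) :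
    v + u ∈ openTangentCone T p ↔ v ∈ openTangentCone T p := by
  refine ⟨fun h => ?_, fun h => add_mem_openTangentCone hT hp h hu.1⟩
  have := add_mem_openTangentCone hT hp h (u := -u) (by rw [← sub_eq_add_neg]; exact hu.2)
  simpa using this

theorem disjoint_openTangentCone {T T' : Set E} (hT : Convex ℝ T) (hT' : Convex ℝ T') {p : E}
    (hp : p ∈ T) (hp' : p ∈ T') (h : Disjoint (interior T) (interior T')) :
    Disjoint (openTangentCone T p) (openTangentCone T' p) := by
  rw [Set.disjoint_left]
  intro v hv hv'
  obtain ⟨ε, h1, h2⟩ := ((eventually_mem_interior_of_mem_openTangentCone hT hp hv).and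
    (eventually_mem_interior_of_mem_openTangentCone hT' hp' hv')).exists
  exact Set.disjoint_left.mp h h1 h2

theorem isOpen_openTangentCone (T : Set E) (p : E) : IsOpen (openTangentCone T p) := by
  have : openTangentCone T p = ⋃ ε : {ε : ℝ // 0 < ε}, (fun v => p + ε.1 • v) ⁻¹' interior T := by
    ext v
    simp [openTangentCone]
  rw [this]
  exact isOpen_iUnion fun ε => isOpen_interior.preimage (by fun_prop)

variable [FiniteDimensional ℝ E] [MeasurableSpace E] [BorelSpace E]

theorem Convex.addHaar_preimage_frontier {T : Set E} (hT : Convex ℝ T) (μ : Measure E)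
    [μ.IsAddHaarMeasure] (p : E) {r : ℝ} (hr : r ≠ 0) :
    μ {v | p + r • v ∈ frontier T} = 0 := by
  have h : {v | p + r • v ∈ frontier T} =
      (r • ·) ⁻¹' ((p + ·) ⁻¹' frontier T) := rfl
  rw [h, Measure.addHaar_preimage_smul μ hr, measure_preimage_add, hT.addHaar_frontier μ, mul_zero]

end TangentCone

/-! ### Tight inequalities and the faces of a polyhedron -/

section Polyhedron

variable {E : Type*} [NormedAddCommGroup E] [InnerProductSpace ℝ E]
variable {ι : Type*}

/-- The solution set of a system of linear inequalities. -/
def solutionSet (a : ι → E) (b : ι → ℝ) : Set E :=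
  {x | ∀ i, inner ℝ (a i) x ≤ b i}

/-- The directions orthogonal to the normals of all inequalities tight at `p`. -/
def tightDirections (a : ι → E) (b : ι → ℝ) (p : E) : Submodule ℝ E where
  carrier := {u | ∀ i, inner ℝ (a i) p = b i → inner ℝ (a i) u = 0}
  add_mem' hx hy i hi := by rw [inner_add_right, hx i hi, hy i hi, add_zero]
  zero_mem' i _ := inner_zero_right _
  smul_mem' c x hx i hi := by rw [inner_smul_right, hx i hi, mul_zero]

theorem mem_tightDirections {a : ι → E} {b : ι → ℝ} {p u : E} :
    u ∈ tightDirections a b p ↔ ∀ i, inner ℝ (a i) p = b i → inner ℝ (a i) u = 0 :=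
  Iff.rfl

theorem eventually_mem_solutionSet [Finite ι] {a : ι → E} {b : ι → ℝ} {q v : E}
    (hq : q ∈ solutionSet a b) (hv : ∀ i, inner ℝ (a i) q = b i → inner ℝ (a i) v ≤ 0) :
    ∀ᶠ ε : ℝ in 𝓝[>] 0, q + ε • v ∈ solutionSet a b ∧
      ∀ i, inner ℝ (a i) q < b i → inner ℝ (a i) (q + ε • v) < b i := by
  have key : ∀ i, ∀ᶠ ε : ℝ in 𝓝[>] 0, inner ℝ (a i) (q + ε • v) ≤ b i ∧
      (inner ℝ (a i) q < b i → inner ℝ (a i) (q + ε • v) < b i) := by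
    intro i
    rcases (hq i).lt_or_eq with h | h
    · have hc : ContinuousAt (fun ε : ℝ => (inner ℝ (a i) (q + ε • v) : ℝ)) 0 := by fun_prop
      have : ∀ᶠ ε : ℝ in 𝓝 0, inner ℝ (a i) (q + ε • v) < b i :=
        hc.eventually_lt_const (by simpa using h)
      filter_upwards [nhdsWithin_le_nhds this] with ε hε using ⟨hε.le, fun _ => hε⟩
    · filter_upwards [self_mem_nhdsWithin] with ε hε
      refine ⟨?_, fun h' => absurd h h'.ne⟩
      rw [inner_add_right, inner_smul_right, h]
      have := mul_nonpos_of_nonneg_of_nonpos (le_of_lt hε) (hv i h)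
      linarith
  filter_upwards [eventually_all.mpr key] with ε hε
    using ⟨fun i => (hε i).1, fun i => (hε i).2⟩

theorem lineality_solutionSet [Finite ι] {a : ι → E} {b : ι → ℝ} {q : E}
    (hq : q ∈ solutionSet a b) :
    lineality (solutionSet a b) q = tightDirections a b q := by
  apply le_antisymm
  · refine Submodule.span_le.mpr fun u hu i hi => ?_
    have h1 := hu.1 i
    have h2 := hu.2 i
    rw [inner_add_right] at h1
    rw [inner_sub_right] at h2
    linarith
  · intro u hu
    obtain ⟨ε, ⟨h1, h2⟩, hε⟩ := (((eventually_mem_solutionSet hq (v := u)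
      fun i hi => (hu i hi).le).and (eventually_mem_solutionSet hq (v := -u)
      fun i hi => by rw [inner_neg_right, hu i hi, neg_zero])).and self_mem_nhdsWithin).exists
    have : ε • u ∈ lineality (solutionSet a b) q :=
      Submodule.subset_span ⟨h1.1, by simpa [sub_eq_add_neg] using h2.1⟩
    exact (Submodule.smul_mem_iff _ (ne_of_gt hε)).mp this

theorem convex_solutionSet (a : ι → E) (b : ι → ℝ) : Convex ℝ (solutionSet a b) := by
  have : solutionSet a b = ⋂ i, {x | innerSL ℝ (a i) x ≤ b i} := by
    ext; simp [solutionSet]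
  rw [this]
  exact convex_iInter fun i => convex_halfSpace_le (innerSL ℝ (a i)).toLinearMap.isLinear _

theorem isClosed_solutionSet (a : ι → E) (b : ι → ℝ) : IsClosed (solutionSet a b) := by
  have : solutionSet a b = ⋂ i, {x | inner ℝ (a i) x ≤ b i} := by
    ext; simp [solutionSet]
  rw [this]
  exact isClosed_iInter fun i => isClosed_le (by fun_prop) (by fun_prop)

theorem inner_lt_of_mem_interior_solutionSet {a : ι → E} {b : ι → ℝ} (ha : ∀ i, a i ≠ 0) {y : E}
    (hy : y ∈ interior (solutionSet a b)) (i : ι) : inner ℝ (a i) y < b i := by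
  have hc : ContinuousAt (fun ε : ℝ => y + ε • a i) 0 := by fun_prop
  have h : ∀ᶠ ε : ℝ in 𝓝 0, y + ε • a i ∈ solutionSet a b :=
    hc.eventually (by simpa using mem_interior_iff_mem_nhds.mp hy)
  obtain ⟨ε, hε, hpos⟩ := ((h.filter_mono (nhdsWithin_le_nhds (s := Set.Ioi 0))).and
    self_mem_nhdsWithin).exists
  have := hε i
  rw [inner_add_right, inner_smul_right] at this
  have h2 : 0 < ε * inner ℝ (a i) (a i) := mul_pos hpos (real_inner_self_pos.mpr (ha i))
  linarith

/-- The directions orthogonal to those tight normals that are orthogonal to `v`. -/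
def tightDirectionsAlong (a : ι → E) (b : ι → ℝ) (q v : E) : Submodule ℝ E where
  carrier := {u | ∀ i, inner ℝ (a i) q = b i → inner ℝ (a i) v = 0 → inner ℝ (a i) u = 0}
  add_mem' hx hy i hi hv := by rw [inner_add_right, hx i hi hv, hy i hi hv, add_zero]
  zero_mem' i _ _ := inner_zero_right _
  smul_mem' c x hx i hi hv := by rw [inner_smul_right, hx i hi hv, mul_zero]

/-- Inside the tangent cone at `q`, moving along a direction `u` of the face containing `v` in its
relative interior, one reaches a smaller face. -/
theorem exists_tightDirectionsAlong_lt [Finite ι] {a : ι → E} {b : ι → ℝ} {q v u : E}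
    (hv : ∀ i, inner ℝ (a i) q = b i → inner ℝ (a i) v ≤ 0)
    (hu : u ∈ tightDirectionsAlong a b q v)
    (huv : u ∉ tightDirections a b q ⊔ Submodule.span ℝ {v})
    {j : ι} (hj : inner ℝ (a j) q = b j) (hju : 0 < inner ℝ (a j) u) :
    ∃ v', (∀ i, inner ℝ (a i) q = b i → inner ℝ (a i) v' ≤ 0) ∧
      v' ∉ tightDirections a b q ∧
      tightDirectionsAlong a b q v' < tightDirectionsAlong a b q v := by
  obtain ⟨i₀, ⟨hi₀, hi₀u⟩, hmin⟩ := Set.exists_min_image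
    {i | inner ℝ (a i) q = b i ∧ 0 < inner ℝ (a i) u}
    (fun i => -inner ℝ (a i) v / inner ℝ (a i) u) (Set.toFinite _) ⟨j, hj, hju⟩
  have hv₀ : inner ℝ (a i₀) v < 0 :=
    lt_of_le_of_ne (hv i₀ hi₀) fun h => hi₀u.ne' (hu i₀ hi₀ h)
  -- The largest step along `u` that stays in the tangent cone; at it the inequality `i₀` becomes an
  -- equality.
  set t : ℝ := -inner ℝ (a i₀) v / inner ℝ (a i₀) u with ht
  have htpos : 0 < t := div_pos (neg_pos.mpr hv₀) hi₀u
  have hi₀v : inner ℝ (a i₀) (v + t • u) = 0 := by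
    rw [inner_add_right, inner_smul_right, ht, div_mul_cancel₀ _ hi₀u.ne']
    ring
  refine ⟨v + t • u, fun i hi => ?_, fun h => huv ?_, lt_of_le_of_ne (fun w hw i hi hiv => ?_) ?_⟩
  · rw [inner_add_right, inner_smul_right]
    rcases lt_or_ge 0 (inner ℝ (a i) u) with hpos | hneg
    · have := hmin i ⟨hi, hpos⟩
      rw [le_div_iff₀ hpos] at this
      linarith
    · have := mul_nonpos_of_nonneg_of_nonpos htpos.le hneg
      linarith [hv i hi]
  · have h1 : t • u ∈ tightDirections a b q ⊔ Submodule.span ℝ {v} := by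
      have := Submodule.sub_mem _ (Submodule.mem_sup_left h)
        (Submodule.mem_sup_right (S := tightDirections a b q)
          (Submodule.mem_span_singleton_self v))
      rwa [add_sub_cancel_left] at this
    exact (Submodule.smul_mem_iff _ htpos.ne').mp h1
  · refine hw i hi ?_
    rw [inner_add_right, inner_smul_right, hiv, hu i hi hiv, mul_zero, add_zero]
  · intro heq
    have : v ∈ tightDirectionsAlong a b q (v + t • u) := by
      rw [heq]
      exact fun i _ h => h
    exact hv₀.ne (this i₀ hi₀ hi₀v)

theorem isExposed_tight [Finite ι] (a : ι → E) (b : ι → ℝ) (J : Set ι) :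
    IsExposed ℝ (solutionSet a b) {x ∈ solutionSet a b | ∀ i ∈ J, inner ℝ (a i) x = b i} := by
  rintro ⟨x₀, hx₀, hx₀'⟩
  set s := J.toFinite.toFinset with hs
  have hmem : ∀ i, i ∈ s ↔ i ∈ J := fun i => by simp [hs]
  have happ : ∀ x, (∑ i ∈ s, innerSL ℝ (a i)) x = ∑ i ∈ s, inner ℝ (a i) x := fun x => by
    simp
  have hle : ∀ y ∈ solutionSet a b, ∑ i ∈ s, inner ℝ (a i) y ≤ ∑ i ∈ s, b i :=
    fun y hy => Finset.sum_le_sum fun i _ => hy i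
  have heq : ∀ y, (∀ i ∈ J, inner ℝ (a i) y = b i) → ∑ i ∈ s, inner ℝ (a i) y = ∑ i ∈ s, b i :=
    fun y hy => Finset.sum_congr rfl fun i hi => hy i ((hmem i).mp hi)
  refine ⟨∑ i ∈ s, innerSL ℝ (a i), Set.ext fun x => and_congr_right fun hx => ?_⟩
  simp only [happ]
  constructor
  · intro h y hy
    rw [heq x h]
    exact hle y hy
  · intro h i hi
    have h1 : ∑ i ∈ s, inner ℝ (a i) x = ∑ i ∈ s, b i :=
      le_antisymm (hle x hx) ((heq x₀ hx₀').symm.le.trans (h x₀ hx₀))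
    exact (Finset.sum_eq_sum_iff_of_le fun i _ => hx i).mp h1 i ((hmem i).mpr hi)

theorem vectorSpan_tight [Finite ι] {a : ι → E} {b : ι → ℝ} {q : E} (hq : q ∈ solutionSet a b) :
    vectorSpan ℝ {x ∈ solutionSet a b | ∀ i ∈ {i | inner ℝ (a i) q = b i}, inner ℝ (a i) x = b i} =
      tightDirections a b q := by
  apply le_antisymm
  · rw [vectorSpan_def, Submodule.span_le]
    rintro _ ⟨x, hx, y, hy, rfl⟩ i hi
    simp only [vsub_eq_sub]
    rw [inner_sub_right, hx.2 i hi, hy.2 i hi, sub_self]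
  · intro u hu
    obtain ⟨ε, ⟨h1, -⟩, hε⟩ := ((eventually_mem_solutionSet hq (v := u)
      fun i hi => (hu i hi).le).and self_mem_nhdsWithin).exists
    have : (q + ε • u) -ᵥ q ∈ vectorSpan ℝ {x ∈ solutionSet a b |
        ∀ i ∈ {i | inner ℝ (a i) q = b i}, inner ℝ (a i) x = b i} := by
      refine vsub_mem_vectorSpan ℝ ⟨h1, fun i hi => ?_⟩ ⟨hq, fun i hi => hi⟩
      rw [inner_add_right, inner_smul_right, hu i hi, mul_zero, add_zero]
      exact hi
    rw [vsub_eq_sub, add_sub_cancel_left] at this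
    exact (Submodule.smul_mem_iff _ (ne_of_gt hε)).mp this

/-- A direction outside the lineality space of a polyhedron at `p` is detected by the normal cone
at `p`. -/
theorem exists_normal_inner_ne_zero [Finite ι] {a : ι → E} {b : ι → ℝ} {p u : E}
    (hp : p ∈ solutionSet a b) (hu : u ∉ lineality (solutionSet a b) p) :
    ∃ c, (∀ x ∈ solutionSet a b, inner ℝ c x ≤ inner ℝ c p) ∧ inner ℝ c u ≠ 0 := by
  simp only [lineality_solutionSet hp, mem_tightDirections, not_forall] at hu
  obtain ⟨i, hi, hiu⟩ := hu
  exact ⟨a i, fun x hx => hi ▸ hx i, hiu⟩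

variable [FiniteDimensional ℝ E]

/-- Passing to ever smaller faces of the tangent cone at `q` must stop, and it stops only at a face
spanned by the lineality space and one further vector. -/
theorem exists_finrank_tightDirectionsAlong_eq [Finite ι] {a : ι → E} {b : ι → ℝ} {q v : E}
    (hv : ∀ i, inner ℝ (a i) q = b i → inner ℝ (a i) v ≤ 0) (hv' : v ∉ tightDirections a b q) :
    ∃ w, (∀ i, inner ℝ (a i) q = b i → inner ℝ (a i) w ≤ 0) ∧
      Module.finrank ℝ (tightDirectionsAlong a b q w) =
        Module.finrank ℝ (tightDirections a b q) + 1 := by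
  induction h : Module.finrank ℝ (tightDirectionsAlong a b q v) using Nat.strong_induction_on
    generalizing v with
  | _ d ih =>
  subst h
  have hle : tightDirections a b q ⊔ Submodule.span ℝ {v} ≤ tightDirectionsAlong a b q v :=
    sup_le (fun u hu i hi _ => hu i hi)
      (by rw [Submodule.span_singleton_le_iff_mem]; exact fun i _ h => h)
  have hfin : Module.finrank ℝ ↥(tightDirections a b q ⊔ Submodule.span ℝ {v}) =
      Module.finrank ℝ (tightDirections a b q) + 1 := by
    have hv0 : v ≠ 0 := fun h0 => hv' (h0 ▸ Submodule.zero_mem _)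
    have h1 := Submodule.finrank_sup_add_finrank_inf_eq (tightDirections a b q)
      (Submodule.span ℝ {v})
    have h2 : tightDirections a b q ⊓ Submodule.span ℝ {v} = ⊥ :=
      disjoint_iff.mp ((Submodule.disjoint_span_singleton' hv0).mpr hv')
    rw [h2, finrank_bot, finrank_span_singleton hv0] at h1
    exact h1
  rcases hle.eq_or_lt with heq | hlt
  · exact ⟨v, hv, by rw [← heq, hfin]⟩
  · obtain ⟨u, hu, huv⟩ := SetLike.exists_of_lt hlt
    have hu' : u ∉ tightDirections a b q := fun h => huv (Submodule.mem_sup_left h)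
    simp only [mem_tightDirections, not_forall] at hu'
    obtain ⟨j, hj, hju⟩ := hu'
    obtain ⟨v', h1, h2, h3⟩ : ∃ v', (∀ i, inner ℝ (a i) q = b i → inner ℝ (a i) v' ≤ 0) ∧
        v' ∉ tightDirections a b q ∧
        tightDirectionsAlong a b q v' < tightDirectionsAlong a b q v := by
      rcases lt_or_gt_of_ne hju with hneg | hpos
      · exact exists_tightDirectionsAlong_lt hv (Submodule.neg_mem _ hu)
          (fun h => huv (by simpa using Submodule.neg_mem _ h)) hj
          (by rw [inner_neg_right]; exact neg_pos.mpr hneg)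
      · exact exists_tightDirectionsAlong_lt hv hu huv hj hpos
    exact ih _ (Submodule.finrank_lt_finrank_of_lt h3) h1 h2 rfl

/-- A short step from `q` into a face of the tangent cone one dimension above the lineality space;
the direction to an interior point starts the search for that face. -/
theorem exists_finrank_tightDirections_succ [Finite ι] {a : ι → E} {b : ι → ℝ}
    (ha : ∀ i, a i ≠ 0) (hint : (interior (solutionSet a b)).Nonempty) {q : E}
    (hq : q ∈ solutionSet a b)
    (hlt : Module.finrank ℝ (tightDirections a b q) < Module.finrank ℝ E) :
    ∃ q' ∈ solutionSet a b, (∀ i, inner ℝ (a i) q' = b i → inner ℝ (a i) q = b i) ∧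
      Module.finrank ℝ (tightDirections a b q') =
        Module.finrank ℝ (tightDirections a b q) + 1 := by
  obtain ⟨y, hy⟩ := hint
  have hneg : ∀ i, inner ℝ (a i) q = b i → inner ℝ (a i) (y - q) < 0 := fun i hi => by
    have := inner_lt_of_mem_interior_solutionSet ha hy i
    rw [inner_sub_right]
    linarith
  have hne : y - q ∉ tightDirections a b q := by
    intro h
    refine hlt.ne ?_
    have : tightDirections a b q = ⊤ := by
      refine eq_top_iff.mpr fun u _ i hi => absurd (h i hi) (hneg i hi).ne
    rw [this, finrank_top]
  obtain ⟨w, hw, hfin⟩ := exists_finrank_tightDirectionsAlong_eq (fun i hi => (hneg i hi).le) hne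
  obtain ⟨ε, ⟨h1, h2⟩, hε⟩ := ((eventually_mem_solutionSet hq hw).and self_mem_nhdsWithin).exists
  have htight : ∀ i, inner ℝ (a i) (q + ε • w) = b i ↔
      inner ℝ (a i) q = b i ∧ inner ℝ (a i) w = 0 := by
    intro i
    rcases (hq i).lt_or_eq with h | h
    · simp [(h2 i h).ne, h.ne]
    · simp [inner_add_right, inner_smul_right, h, (ne_of_gt hε : ε ≠ 0)]
  refine ⟨q + ε • w, h1, fun i hi => ((htight i).mp hi).1, ?_⟩
  have : tightDirections a b (q + ε • w) = tightDirectionsAlong a b q w := by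
    ext u
    exact forall_congr' fun i => by rw [htight i, and_imp]
  rw [this, hfin]

theorem exists_finrank_tightDirections_add [Finite ι] {a : ι → E} {b : ι → ℝ}
    (ha : ∀ i, a i ≠ 0) (hint : (interior (solutionSet a b)).Nonempty) {p : E}
    (hp : p ∈ solutionSet a b) (d : ℕ)
    (hd : Module.finrank ℝ (tightDirections a b p) + d ≤ Module.finrank ℝ E) :
    ∃ q ∈ solutionSet a b, (∀ i, inner ℝ (a i) q = b i → inner ℝ (a i) p = b i) ∧
      Module.finrank ℝ (tightDirections a b q) =
        Module.finrank ℝ (tightDirections a b p) + d := by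
  induction d with
  | zero => exact ⟨p, hp, fun _ h => h, rfl⟩
  | succ d ih =>
    obtain ⟨q, hq, h1, h2⟩ := ih (by omega)
    obtain ⟨q', hq', h1', h2'⟩ := exists_finrank_tightDirections_succ ha hint hq (by omega)
    exact ⟨q', hq', fun i hi => h1 i (h1' i hi), by omega⟩

end Polyhedron

/-! ### Faces and tangent cones of tiles -/

section Tiling

variable {n : ℕ}

theorem IsPolyhedron.exists_eq_solutionSet {P : Set (EuclideanSpace ℝ (Fin n))}
    (hP : IsPolyhedron P) :
    ∃ (ι : Type) (_ : Finite ι) (a : ι → EuclideanSpace ℝ (Fin n)) (b : ι → ℝ),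
      (∀ i, a i ≠ 0) ∧ P = solutionSet a b := by
  obtain ⟨S, hS, hH, rfl⟩ := hP
  choose a ha b hb using fun H : S => hH H.1 H.2
  refine ⟨S, hS, a, b, ha, ?_⟩
  ext x
  simp only [Set.mem_sInter, solutionSet, Set.mem_ofPred_eq]
  constructor
  · intro h H
    have := h H.1 H.2
    rwa [hb H] at this
  · intro h H hHS
    exact (Set.ext_iff.mp (hb ⟨H, hHS⟩) x).mpr (h ⟨H, hHS⟩)

theorem IsPolyhedron.convex {P : Set (EuclideanSpace ℝ (Fin n))} (hP : IsPolyhedron P) :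
    Convex ℝ P := by
  obtain ⟨ι, _, a, b, -, rfl⟩ := hP.exists_eq_solutionSet
  exact convex_solutionSet a b

theorem IsPolyhedron.isClosed {P : Set (EuclideanSpace ℝ (Fin n))} (hP : IsPolyhedron P) :
    IsClosed P := by
  obtain ⟨ι, _, a, b, -, rfl⟩ := hP.exists_eq_solutionSet
  exact isClosed_solutionSet a b

theorem IsPolyhedron.exists_normal_inner_ne_zero {P : Set (EuclideanSpace ℝ (Fin n))}
    (hP : IsPolyhedron P) {p u : EuclideanSpace ℝ (Fin n)} (hp : p ∈ P) (hu : u ∉ lineality P p) :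
    ∃ c, (∀ x ∈ P, inner ℝ c x ≤ inner ℝ c p) ∧ inner ℝ c u ≠ 0 := by
  obtain ⟨ι, _, a, b, -, rfl⟩ := hP.exists_eq_solutionSet
  exact _root_.exists_normal_inner_ne_zero hp hu

/-- Every point of a face of dimension `k` has lineality of dimension at most `k`. -/
theorem IsKFace.finrank_lineality_le {k : ℕ} {P F : Set (EuclideanSpace ℝ (Fin n))}
    (hF : IsKFace k P F) {p : EuclideanSpace ℝ (Fin n)} (hp : p ∈ F) :
    Module.finrank ℝ (lineality P p) ≤ k := by
  obtain ⟨hne, hexp, rfl⟩ := hF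
  refine Submodule.finrank_mono (Submodule.span_le.mpr ?_)
  rintro u ⟨h1, h2⟩
  obtain ⟨l, rfl⟩ := hexp hne
  have e1 := hp.2 _ h1
  have e2 := hp.2 _ h2
  rw [map_add] at e1
  rw [map_sub] at e2
  -- As `l` is maximal at `p`, the points `p + u` and `p - u` force `l u = 0`.
  have hmem : p + u ∈ {x ∈ P | ∀ y ∈ P, l y ≤ l x} := by
    refine ⟨h1, fun y hy => ?_⟩
    rw [map_add]
    linarith [hp.2 y hy]
  have := vsub_mem_vectorSpan ℝ hmem hp
  rwa [vsub_eq_sub, add_sub_cancel_left] at this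

/-- Finitely many `k`-faces of a full-dimensional polyhedron cover all its points with lineality
of dimension at most `k`. -/
theorem IsPolyhedron.exists_finite_kFaces {k : ℕ} (hk : k ≤ n)
    {P : Set (EuclideanSpace ℝ (Fin n))} (hP : IsPolyhedron P) (hint : (interior P).Nonempty) :
    ∃ 𝓖 : Set (Set (EuclideanSpace ℝ (Fin n))), 𝓖.Finite ∧ (∀ G ∈ 𝓖, IsKFace k P G) ∧
      ∀ p ∈ P, Module.finrank ℝ (lineality P p) ≤ k → p ∈ ⋃₀ 𝓖 := by
  obtain ⟨ι, _, a, b, ha, rfl⟩ := hP.exists_eq_solutionSet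
  refine ⟨{G | IsKFace k (solutionSet a b) G} ∩
    Set.range fun J : Set ι => {x ∈ solutionSet a b | ∀ i ∈ J, inner ℝ (a i) x = b i},
    (Set.finite_range _).subset Set.inter_subset_right, fun G hG => hG.1, fun p hp hpk => ?_⟩
  rw [lineality_solutionSet hp] at hpk
  -- The inequalities tight at `q` are also tight at `p`, so the `k`-face around `q` contains `p`.
  obtain ⟨q, hq, hqp, hfin⟩ := exists_finrank_tightDirections_add ha hint hp
    (k - Module.finrank ℝ (tightDirections a b p))
    (by rw [Nat.add_sub_cancel' hpk, finrank_euclideanSpace_fin]; exact hk)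
  have hface : IsKFace k (solutionSet a b)
      {x ∈ solutionSet a b | ∀ i ∈ {i | inner ℝ (a i) q = b i}, inner ℝ (a i) x = b i} := by
    refine ⟨⟨q, hq, fun i hi => hi⟩, isExposed_tight a b _, ?_⟩
    rw [vectorSpan_tight hq, hfin, Nat.add_sub_cancel' hpk]
  exact ⟨_, ⟨hface, _, rfl⟩, hp, hqp⟩

variable {𝒯 : Set (Set (EuclideanSpace ℝ (Fin n)))}

theorem IsLocallyFiniteTiling.finite_mem (hfin : IsLocallyFiniteTiling 𝒯)
    (p : EuclideanSpace ℝ (Fin n)) : {T ∈ 𝒯 | p ∈ T}.Finite :=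
  (hfin {p} Bornology.isBounded_singleton).subset
    fun _ hT => ⟨hT.1, p, hT.2, rfl⟩

theorem IsLocallyFiniteTiling.eventually_mem (htiling : IsPolytopalTiling 𝒯)
    (hfin : IsLocallyFiniteTiling 𝒯) (p : EuclideanSpace ℝ (Fin n)) :
    ∀ᶠ y in 𝓝 p, ∀ T ∈ 𝒯, y ∈ T → p ∈ T := by
  have h1 := (eventually_all_finite (hfin _ (Metric.isBounded_ball (x := p) (r := 1)))
    (l := 𝓝 p) (p := fun T y => y ∈ T → p ∈ T)).mpr fun T hT => by
      by_cases hp : p ∈ T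
      · exact Eventually.of_forall fun _ _ => hp
      · filter_upwards [(htiling.isPolytope T hT.1).1.isClosed.isOpen_compl.mem_nhds hp]
          with y hy h using absurd h hy
  filter_upwards [h1, Metric.ball_mem_nhds p one_pos] with y hy hball T hT hyT
    using hy T ⟨hT, y, hyT, hball⟩ hyT

/-- Up to a null set, the open tangent cones at `p` of the tiles containing `p` cover the space. -/
theorem IsPolytopalTiling.exists_null_openTangentCone (htiling : IsPolytopalTiling 𝒯)
    (hfin : IsLocallyFiniteTiling 𝒯) (p : EuclideanSpace ℝ (Fin n)) :
    ∃ N : Set (EuclideanSpace ℝ (Fin n)), volume N = 0 ∧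
      ∀ v ∉ N, ∃ T ∈ 𝒯, p ∈ T ∧ v ∈ openTangentCone T p := by
  refine ⟨⋃ T ∈ {T ∈ 𝒯 | p ∈ T}, ⋃ m : ℕ, {v | p + (1 / ((m : ℝ) + 1)) • v ∈ frontier T},
    ?_, fun v hv => ?_⟩
  · refine (measure_biUnion_null_iff (hfin.finite_mem p).countable).mpr fun T hT =>
      measure_iUnion_null fun m => ?_
    exact (htiling.isPolytope T hT.1).1.convex.addHaar_preimage_frontier volume p
      (by positivity)
  · have hlim : Tendsto (fun m : ℕ => p + (1 / ((m : ℝ) + 1)) • v) atTop (𝓝 p) := by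
      simpa using ((tendsto_one_div_add_atTop_nhds_zero_nat (𝕜 := ℝ)).smul_const v).const_add p
    obtain ⟨m, hm⟩ := (hlim.eventually (hfin.eventually_mem htiling p)).exists
    have huniv : p + (1 / ((m : ℝ) + 1)) • v ∈ ⋃₀ 𝒯 := htiling.covering ▸ Set.mem_univ _
    obtain ⟨T, hT, hmT⟩ := huniv
    have hpT := hm T hT hmT
    refine ⟨T, hT, hpT, 1 / ((m : ℝ) + 1), by positivity, ?_⟩
    by_contra hnot
    refine hv (Set.mem_biUnion (show T ∈ {T ∈ 𝒯 | p ∈ T} from ⟨hT, hpT⟩)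
      (Set.mem_iUnion.mpr ⟨m, ?_⟩))
    exact ⟨subset_closure hmT, hnot⟩

/-- If the lineality of a tile at `p` is not the whole space, then another tile has smaller or
equal lineality at `p`. -/
theorem IsPolytopalTiling.exists_lineality_le (htiling : IsPolytopalTiling 𝒯)
    (hfin : IsLocallyFiniteTiling 𝒯) {T : Set (EuclideanSpace ℝ (Fin n))} (hT : T ∈ 𝒯)
    {p : EuclideanSpace ℝ (Fin n)} (hp : p ∈ T) (htop : lineality T p ≠ ⊤) :
    ∃ T' ∈ 𝒯, T' ≠ T ∧ p ∈ T' ∧ lineality T' p ≤ lineality T p := by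
  classical
  by_contra hcon
  obtain ⟨N, hN, hcover⟩ := htiling.exists_null_openTangentCone hfin p
  obtain ⟨u₀, -, hu₀⟩ := SetLike.exists_of_lt (lt_top_iff_ne_top.mpr htop)
  -- For `S = T` any vector outside the lineality will do: that slot will carry the indicator of
  -- `G`, which has every `u S` as a period.
  have hex : ∀ S : {S // S ∈ 𝒯 ∧ p ∈ S}, ∃ u, u ∉ lineality T p ∧
      (S.1 ≠ T → p + u ∈ S.1 ∧ p - u ∈ S.1) := by
    rintro ⟨S, hS, hpS⟩
    by_cases hST : S = T
    · exact ⟨u₀, hu₀, fun h => absurd hST h⟩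
    · by_contra hno
      push Not at hno
      refine hcon ⟨S, hS, hST, hpS, Submodule.span_le.mpr fun u hu => ?_⟩
      by_contra hu'
      exact (hno u hu').2 hu.1 hu.2
  choose u hu hper using hex
  have : Finite {S // S ∈ 𝒯 ∧ p ∈ S} := hfin.finite_mem p
  have := Fintype.ofFinite {S // S ∈ 𝒯 ∧ p ∈ S}
  have hcvx : ∀ S ∈ 𝒯, Convex ℝ S := fun S hS => (htiling.isPolytope S hS).1.convex
  set G := avoidingPoints u N
  let χ : Set (EuclideanSpace ℝ (Fin n)) → EuclideanSpace ℝ (Fin n) → ℤ :=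
    fun S => (openTangentCone S p ∩ G).indicator 1
  have hχ : ∀ S v, χ S v = if v ∈ openTangentCone S p ∧ v ∈ G then 1 else 0 := fun S v => by
    simp only [χ, Set.indicator_apply, Set.mem_inter_iff, Pi.one_apply]
  let T₀ : {S // S ∈ 𝒯 ∧ p ∈ S} := ⟨T, hT, hp⟩
  have hzero : ∀ v, χ T v = 0 := by
    refine eq_zero_of_eq_sum_periodic Finset.univ u
      {c | ∀ x ∈ T, inner ℝ c x ≤ inner ℝ c p} (fun S _ => ?_)
      (fun S v => if S = T₀ then G.indicator 1 v else -χ S v) (fun S _ x => ?_) (χ T)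
      (fun c hc => ⟨0, fun x hx => ?_⟩) fun v => ?_
    · exact (htiling.isPolytope T hT).1.exists_normal_inner_ne_zero hp (hu S)
    · have hGS : x + u S ∈ G ↔ x ∈ G := add_mem_avoidingPoints_iff u N S x
      by_cases hS : S = T₀
      · simp only [hS, if_true, Set.indicator_apply, Pi.one_apply]
        rw [← hS, hGS]
      · have hST : S.1 ≠ T := fun h => hS (Subtype.ext h)
        simp only [hS, if_false, hχ, hGS,
          add_mem_openTangentCone_iff (hcvx S.1 S.2.1) S.2.2 (hper S hST)]
    · have hx' : x ∈ openTangentCone T p := by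
        by_contra h
        exact hx (by simp [hχ, h])
      obtain ⟨ε, hε, hmem⟩ := hx'
      have := hc _ (interior_subset hmem)
      rw [inner_add_right, inner_smul_right] at this
      by_contra hpos
      have := mul_pos hε (not_le.mp hpos)
      linarith
    · have hsum : ∑ S : {S // S ∈ 𝒯 ∧ p ∈ S}, χ S v = G.indicator 1 v := by
        by_cases hv : v ∈ G
        · obtain ⟨S, hS, hpS, hvS⟩ := hcover v (notMem_of_mem_avoidingPoints hv)
          rw [Finset.sum_eq_single (⟨S, hS, hpS⟩ : {S // S ∈ 𝒯 ∧ p ∈ S})]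
          · simp [hχ, hv, hvS]
          · rintro ⟨S', hS', hpS'⟩ - hne
            have hne' : S' ≠ S := fun h => hne (Subtype.ext h)
            have := Set.disjoint_right.mp (disjoint_openTangentCone (hcvx S' hS') (hcvx S hS)
              hpS' hpS (htiling.packing S' hS' S hS hne')) hvS
            simp [hχ, this]
          · simp
        · simp [hχ, hv]
      rw [← Finset.add_sum_erase _ _ (Finset.mem_univ T₀), if_pos rfl, ← hsum,
        ← Finset.add_sum_erase _ _ (Finset.mem_univ T₀), add_assoc, ← Finset.sum_add_distrib,
        Finset.sum_eq_zero, add_zero]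
      intro S hS
      rw [if_neg (Finset.ne_of_mem_erase hS), add_neg_cancel]
  obtain ⟨y, hy⟩ := htiling.interior_nonempty T hT
  have hpos : 0 < volume (openTangentCone T p) :=
    (isOpen_openTangentCone T p).measure_pos volume ⟨y - p, sub_mem_openTangentCone hy⟩
  have hGae : ∀ᵐ x ∂(volume : Measure (EuclideanSpace ℝ (Fin n))), x ∈ G :=
    ae_mem_avoidingPoints u hN
  obtain ⟨x, hx, hxG⟩ := ((frequently_ae_mem_iff.mpr hpos.ne').and_eventually hGae).exists
  have := hzero x
  simp [hχ, hx, hxG] at this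

end Tiling

theorem mainTheorem6 {n k : ℕ} (hk : k < n)
    (𝒯 : Set (Set (EuclideanSpace ℝ (Fin n))))
    (htiling : IsPolytopalTiling 𝒯) (hfin : IsLocallyFiniteTiling 𝒯)
    (T : Set (EuclideanSpace ℝ (Fin n))) (hT : T ∈ 𝒯)
    (F : Set (EuclideanSpace ℝ (Fin n))) (hF : IsKFace k T F) :
    ∃ 𝓕 : Set (Set (EuclideanSpace ℝ (Fin n))),
      𝓕.Finite ∧ (∀ G ∈ 𝓕, ∃ T' ∈ 𝒯, T' ≠ T ∧ IsKFace k T' G) ∧ F ⊆ ⋃₀ 𝓕 := by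
  choose! 𝓖 h𝓖fin h𝓖face h𝓖cover using fun T' (hT' : T' ∈ 𝒯) =>
    (htiling.isPolytope T' hT').1.exists_finite_kFaces hk.le (htiling.interior_nonempty T' hT')
  refine ⟨⋃ T' ∈ {T' ∈ 𝒯 | (T' ∩ T).Nonempty} \ {T}, 𝓖 T', ?_, fun G hG => ?_, fun p hp => ?_⟩
  · exact (hfin T (htiling.isPolytope T hT).2).sdiff.biUnion fun T' hT' => h𝓖fin T' hT'.1.1
  · obtain ⟨T', hT', hG'⟩ := Set.mem_iUnion₂.mp hG
    exact ⟨T', hT'.1.1, hT'.2, h𝓖face T' hT'.1.1 G hG'⟩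
  · have hpT : p ∈ T := hF.2.1.subset hp
    have hdim := hF.finrank_lineality_le hp
    -- Here `k < n` is what rules out full lineality, that is, `p` interior to `T`.
    obtain ⟨T', hT', hne, hpT', hle⟩ := htiling.exists_lineality_le hfin hT hpT fun h => by
      rw [h, finrank_top, finrank_euclideanSpace_fin] at hdim
      omega
    obtain ⟨G, hG, hpG⟩ := h𝓖cover T' hT' p hpT' ((Submodule.finrank_mono hle).trans hdim)
    exact ⟨G, Set.mem_biUnion ⟨⟨hT', p, hpT', hpT⟩, hne⟩ hG, hpG⟩
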